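/- Let $\mathcal X\subseteq\mathbb R^d$, let $\mathcal W\subseteq\mathbb R^d$ be nonempty and symmetric ($w\in\mathcal W\Rightarrow -w\in\mathcal W$) with $\langle w,x\rangle\le 1$ for all $x\in\mathcal X,\ w\in\mathcal W$, and let $\mathcal Y\subset\mathbb R$ be compact with $\pm1\in\mathcal Y$. Let $\overline{\mathcal T}$ be a real vector space, $\overline{\mathbf T}:\mathcal X\to\overline{\mathcal T}$ a map with $\overline{\mathbf T}(x^0)=0$ for some $x^0\in\mathcal X$, and $F:\overline{\mathcal T}\to\mathbb R$ an arbitrary function. Put $\mathcal T=\mathbb R\times\mathbb R^d\times\overline{\mathcal T}$ and, for $z=(x,\hat y)\in\mathcal X\times\mathcal Y$ and $\delta\in[-1,1]$, $$\mathbf T(z,\delta)=(\hat y\,\delta,\ \delta x,\ \overline{\mathbf T}(x)),\qquad V(a,v,s)=a+\sup_{w\in\mathcal W}\langle w,v\rangle-F(s)\in(-\infty,\infty].$$ A loss $\ell:\mathbb R\times\mathbb R\to\mathbb R$ is *admissible* if for every $y\in\mathcal Y$ the function $\ell(\cdot,y)$ is convex and $1$-Lipschitz on the convex hull of $\mathcal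 Y$; $\ell$ is bounded on $\mathcal Y\times\mathcal Y$ and measurable in $y\in\mathcal Y$; and for every Borel probability measure $p$ on $\mathcal Y$ some minimizer over $\hat y\in\mathbb R$ of $\mathbb E_{y\sim p}\,\ell(\hat y,y)$ lies in $\mathcal Y$ (points $\hat y$ at which $\ell(\hat y,\cdot)$ is not $p$-integrable do not compete). The regret bound is *achievable for* $\ell$ if for every $n\ge1$ there is a randomized forecaster (choosing the law $q_t$ of $\hat y_t$ on $\mathcal Y$ as a function of $x_1,y_1,\dots,x_{t-1},y_{t-1},x_t$) such that for all $(x_1,y_1),\dots,(x_n,y_n)\in\mathcal X\times\mathcal Y$ $$\sum_{t=1}^n\mathbb E_{\hat y_t\sim q_t}\,\ell(\hat y_t,y_t)-\inf_{w\in\mathcal W}\sum_{t=1}^n\ell(\langle w,x_t\rangle,y_t)\ \le\ F\Big(\sum_{t=1}^n\overline{\mathbf T}(x_t)\Big).$$ A *Burkholder function* for $(\mathbf T,V)$ is a function $\mathbf U:\mathcal T\to(-\infty,\infty]$ with ($1^o$) $\mathbf U(0)\le0$; ($2^o$) $\mathbf U\ge V$; and either ($3^o$) for all $\tau\in\mathcal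 T$, $z\in\mathcal X\times\mathcal Y$ the map $\alpha\mapsto\mathbf U(\tau+\mathbf T(z,\alpha))$ is Borel on $[-1,1]$ and $\mathbb E_{\alpha\sim p}\,\mathbf U(\tau+\mathbf T(z,\alpha))\le\mathbf U(\tau)$ for every mean-zero probability measure $p$ on $[-1,1]$, or ($3'$) for all $\tau,z$ the map $\alpha\mapsto\mathbf U(\tau+\mathbf T(z,\alpha))$ is convex on $[-1,1]$ and $\tfrac12\mathbf U(\tau+\mathbf T(z,1))+\tfrac12\mathbf U(\tau+\mathbf T(z,-1))\le\mathbf U(\tau)$. Then the following are equivalent: (a) there is a Burkholder function for $(\mathbf T,V)$ satisfying $1^o,2^o,3^o$; (b) there is a Burkholder function for $(\mathbf T,V)$ satisfying $1^o,2^o,3'$; (c) the regret bound is achievable for every admissible loss; (d) the regret bound is achievable for the absolute loss $\ell(\hat y,y)=|\hat y-y|$. Moreover, if $\mathcal W$ is bounded (so that $V$ is real-valued) and for every $s\in\overline{\mathcal T}$ there is $C$ with $F(\sum_{t=1}^m\overline{\mathbf T}(x_t))\le F(s+\sum_{t=1}^m\overline{\mathbf T}(x_t))+C$ for all $m\ge0$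 and $x_1,\dots,x_m\in\mathcal X$ (for instance if $F$ is Lipschitz for a norm), then the same four statements are equivalent with real-valued $\mathbf U:\mathcal T\to\mathbb R$ in (a) and (b). -/

import Mathlib

open MeasureTheory

noncomputable section

namespace OnlineLearning

/-! ### Burkholder functions for a statistic `T : Z × [-1,1] → S` and `V : S → (-∞, ∞]`

The derivative bound is `L = 1`. Values `+∞` are allowed, as for any function built as a supremum. -/

/-- Expectation of an extended-real function as (integral of the positive part) minus (integral of
the negative part). It is used below only for functions bounded from below. -/
def expect {A : Type*} [MeasurableSpace A] (p : Measure A) (g : A → EReal) : EReal :=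
  ((∫⁻ a, (g a).toENNReal ∂p : ENNReal) : EReal) - ((∫⁻ a, (-g a).toENNReal ∂p : ENNReal) : EReal)

/-- The Burkholder properties `1°`, `2°`, `3°`: `U 0 ≤ 0`, `V ≤ U`, and restricted concavity, i.e.
`E U (τ + T (z, α)) ≤ U τ` for every mean-zero law `p` of `α` on `[-1,1]`
(the integrand being Borel, so that the expectation makes sense). -/
structure IsBurkholder {Z S : Type*} [AddCommGroup S]
    (T : Z → ℝ → S) (V U : S → EReal) : Prop where
  zero_le : U 0 ≤ 0
  majorant : ∀ τ, V τ ≤ U τ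
  measurable : ∀ τ z, Measurable (fun α : Set.Icc (-1 : ℝ) 1 => U (τ + T z α))
  concave : ∀ τ z (p : ProbabilityMeasure (Set.Icc (-1 : ℝ) 1)),
    ∫ α : Set.Icc (-1 : ℝ) 1, (α : ℝ) ∂(p : Measure (Set.Icc (-1 : ℝ) 1)) = 0 →
    expect (p : Measure (Set.Icc (-1 : ℝ) 1)) (fun α => U (τ + T z α)) ≤ U τ

/-- The Burkholder properties `1°`, `2°`, `3'`: `U 0 ≤ 0`, `V ≤ U`, the map
`α ↦ U (τ + T (z, α))` is convex on `[-1,1]`, and `E U (τ + T (z, ε)) ≤ U τ` for a Rademacher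
variable `ε`. -/
structure IsConvexBurkholder {Z S : Type*} [AddCommGroup S]
    (T : Z → ℝ → S) (V U : S → EReal) : Prop where
  zero_le : U 0 ≤ 0
  majorant : ∀ τ, V τ ≤ U τ
  convex : ∀ τ z, ∀ α ∈ Set.Icc (-1 : ℝ) 1, ∀ β ∈ Set.Icc (-1 : ℝ) 1,
    ∀ a b : ℝ, 0 ≤ a → 0 ≤ b → a + b = 1 →
      U (τ + T z (a * α + b * β)) ≤ (a : EReal) * U (τ + T z α) + (b : EReal) * U (τ + T z β)
  rademacher : ∀ τ z,
    ((1 / 2 : ℝ) : EReal) * U (τ + T z 1) + ((1 / 2 : ℝ) : EReal) * U (τ + T z (-1)) ≤ U τ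

/-! ### The natural pair for a linear class -/

/-- `T (x, ŷ, δ) = (ŷ δ, δ x, T̄ x)`. -/
def natT {d : ℕ} {S : Type*} (X : Set (EuclideanSpace ℝ (Fin d))) (Y : Set ℝ) (Tbar : X → S) :
    X × Y → ℝ → ℝ × EuclideanSpace ℝ (Fin d) × S :=
  fun z δ => ((z.2 : ℝ) * δ, δ • (z.1 : EuclideanSpace ℝ (Fin d)), Tbar z.1)

/-- `V (a, v, s) = a + sup_{w ∈ W} ⟨w, v⟩ - F s`. The supremum is taken in the extended reals. -/
def natV {d : ℕ} {S : Type*} (W : Set (EuclideanSpace ℝ (Fin d))) (F : S → ℝ) :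
    ℝ × EuclideanSpace ℝ (Fin d) × S → EReal :=
  fun τ => (τ.1 : EReal)
    + (⨆ w : W, ((inner ℝ (w : EuclideanSpace ℝ (Fin d)) τ.2.1 : ℝ) : EReal))
    - (F τ.2.2 : EReal)

/-! ### Losses and achievability -/

/-- The standing assumptions on a loss `ℓ ŷ y` over the label set `Y`, with Lipschitz constant `1`.
Convexity and the Lipschitz bound are required on the convex hull of `Y` (which is `Y` itself when
`Y` is an interval). -/
structure IsAdmissibleLoss (Y : Set ℝ) (ℓ : ℝ → ℝ → ℝ) : Prop where
  convex : ∀ y ∈ Y, ConvexOn ℝ (convexHull ℝ Y) (fun u => ℓ u y)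
  lipschitz : ∀ y ∈ Y, LipschitzOnWith 1 (fun u => ℓ u y) (convexHull ℝ Y)
  bounded : ∃ C : ℝ, ∀ u ∈ Y, ∀ y ∈ Y, |ℓ u y| ≤ C
  measurable : ∀ u : ℝ, Measurable (fun y : Y => ℓ u y)
  /-- For every law `p` on `Y` some minimizer over `ℝ` of `E ℓ (·, y)` lies in `Y`
  (points at which the expectation is not finite do not compete). -/
  argmin_mem : ∀ p : ProbabilityMeasure Y, ∃ u ∈ Y, ∀ v : ℝ,
    Integrable (fun y : Y => ℓ v y) (p : Measure Y) →
      ∫ y : Y, ℓ u y ∂(p : Measure Y) ≤ ∫ y : Y, ℓ v y ∂(p : Measure Y)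

/-- The regret bound `F (∑ T̄ x_t)` against the class `{x ↦ ⟨w, x⟩ : w ∈ W}` is achievable for `ℓ`:
for every horizon `n ≥ 1` there is a randomized forecaster, which maps the past rounds
`(x_1, y_1), …, (x_{t-1}, y_{t-1})` and the current `x_t` to the law on `Y` from which the
prediction is drawn, whose expected regret obeys the bound for all sequences. -/
def Achievable {d : ℕ} {S : Type*} [AddCommGroup S]
    (X W : Set (EuclideanSpace ℝ (Fin d))) (Y : Set ℝ) (Tbar : X → S) (F : S → ℝ)
    (ℓ : ℝ → ℝ → ℝ) : Prop :=
  ∀ n : ℕ, 1 ≤ n → ∃ q : List (X × Y) → X → ProbabilityMeasure Y,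
    ∀ (x : Fin n → X) (y : Fin n → Y),
      (∑ t : Fin n, ∫ u : Y, ℓ u (y t)
          ∂(q ((List.ofFn fun s => (x s, y s)).take (t : ℕ)) (x t) : Measure Y))
        - (⨅ w : W, ∑ t : Fin n, ℓ (inner ℝ (w : EuclideanSpace ℝ (Fin d)) (x t)) (y t))
      ≤ F (∑ t : Fin n, Tbar (x t))

end OnlineLearning

end

noncomputable section

namespace OnlineLearning

/-! All four statements are equivalent to `NonposPayoff`: no finite tree strategy of the adversary
has positive mean payoff `⟨w, ∑ ε x⟩ - F (∑ Tbar x)`, where fair coins ε select the branch and the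
leaf names the competitor w.

Against the absolute loss, random labels ±1 cost any forecaster at least 1 per round on average,
while w pays `1 - ε⟨w, x⟩`. A regret bound therefore forces `NonposPayoff` (`payoff_add_nonpos`).
Any Burkholder function dominates all payoffs, since it majorizes V at the leaves and decreases on
average at the nodes (`add_payoff_le_of_rademacher`).

Conversely, the supremum of all payoffs, `leastU`, is a Burkholder function: each payoff is affine
in v, so the supremum is convex in α, and joining two trees under a node gives the Rademacher
inequality. Convexity upgrades this to all mean-zero laws, because a convex function lies below its
chord. For the forecaster, the same joining of trees yields a prediction g in [-1, 1] that keeps all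
payoffs bounded (`exists_prediction`). Subgradients reduce a convex loss to this linear game, and a
law on two neighbours of g in Y replaces g (`exists_randomized_prediction`). -/

/-- Two families of reals, one below the other, are separated by a real number. -/
theorem exists_between_sets {A B : Set ℝ} (hA : A.Nonempty) (hB : B.Nonempty)
    (h : ∀ a ∈ A, ∀ b ∈ B, a ≤ b) : ∃ c, (∀ a ∈ A, a ≤ c) ∧ ∀ b ∈ B, c ≤ b := by
  obtain ⟨b₀, hb₀⟩ := hB
  exact ⟨sSup A, fun a ha => le_csSup ⟨b₀, fun x hx => h x hx b₀ hb₀⟩ ha,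
    fun b hb => csSup_le hA fun a ha => h a ha b hb⟩

/-! ### Two-point laws -/

section TwoPoint

variable {A : Type*} [MeasurableSpace A]

/-- The law which gives mass `θ` to `a` and mass `1 - θ` to `b`. -/
def twoPoint (θ : Set.Icc (0 : ℝ) 1) (a b : A) : ProbabilityMeasure A :=
  ⟨ENNReal.ofReal θ • Measure.dirac a + ENNReal.ofReal (1 - θ) • Measure.dirac b, ⟨by
    have h₀ := θ.2.1
    have h₁ := θ.2.2
    simp only [Measure.coe_add, Measure.coe_smul, Pi.add_apply, Pi.smul_apply, measure_univ,
      smul_eq_mul, mul_one]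
    rw [← ENNReal.ofReal_add h₀ (by linarith)]
    simp⟩⟩

theorem twoPoint_coe (θ : Set.Icc (0 : ℝ) 1) (a b : A) :
    (twoPoint θ a b : Measure A) =
      ENNReal.ofReal θ • Measure.dirac a + ENNReal.ofReal (1 - θ) • Measure.dirac b := rfl

variable [MeasurableSingletonClass A]

theorem integrable_twoPoint (θ : Set.Icc (0 : ℝ) 1) (a b : A) (f : A → ℝ) :
    Integrable f (twoPoint θ a b : Measure A) := by
  rw [twoPoint_coe]
  exact ((integrable_dirac (by simp)).smul_measure (by simp)).add_measure
    ((integrable_dirac (by simp)).smul_measure (by simp))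

theorem integral_twoPoint (θ : Set.Icc (0 : ℝ) 1) (a b : A) (f : A → ℝ) :
    ∫ x, f x ∂(twoPoint θ a b : Measure A) = θ * f a + (1 - θ) * f b := by
  have h₀ := θ.2.1
  have h₁ := θ.2.2
  rw [twoPoint_coe, integral_add_measure ((integrable_dirac (by simp)).smul_measure (by simp))
    ((integrable_dirac (by simp)).smul_measure (by simp)), integral_smul_measure,
    integral_smul_measure, integral_dirac, integral_dirac, ENNReal.toReal_ofReal h₀,
    ENNReal.toReal_ofReal (by linarith)]
  rfl

theorem ae_twoPoint (θ : Set.Icc (0 : ℝ) 1) (a b : A) {P : A → Prop} (ha : P a) (hb : P b) :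
    ∀ᵐ x ∂(twoPoint θ a b : Measure A), P x := by
  rw [twoPoint_coe, ae_add_measure_iff]
  constructor
  · refine Measure.ae_smul_measure ?_ _
    rw [ae_dirac_eq]
    exact ha
  · refine Measure.ae_smul_measure ?_ _
    rw [ae_dirac_eq]
    exact hb

end TwoPoint

/-! ### The extended expectation -/

section Expect

variable {A : Type*} [MeasurableSpace A]

theorem expect_mono_ae {p : Measure A} {f g : A → EReal} (h : ∀ᵐ a ∂p, f a ≤ g a) :
    expect p f ≤ expect p g := by
  refine EReal.sub_le_sub ?_ ?_
  · exact EReal.coe_ennreal_le_coe_ennreal_iff.2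
      (lintegral_mono_ae (h.mono fun a ha => EReal.toENNReal_le_toENNReal ha))
  · exact EReal.coe_ennreal_le_coe_ennreal_iff.2
      (lintegral_mono_ae (h.mono fun a ha =>
        EReal.toENNReal_le_toENNReal (EReal.neg_le_neg_iff.2 ha)))

theorem expect_coe {p : Measure A} {f : A → ℝ} (hf : Integrable f p) :
    expect p (fun a => (f a : EReal)) = ((∫ a, f a ∂p : ℝ) : EReal) := by
  have h₁ : ∫⁻ a, ENNReal.ofReal (f a) ∂p ≠ ⊤ := hf.lintegral_lt_top.ne
  have h₂ : ∫⁻ a, ENNReal.ofReal (-f a) ∂p ≠ ⊤ := hf.neg.lintegral_lt_top.ne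
  rw [integral_eq_lintegral_pos_part_sub_lintegral_neg_part hf, EReal.coe_sub,
    EReal.coe_ennreal_toReal h₁, EReal.coe_ennreal_toReal h₂]
  simp only [expect, ← EReal.coe_neg, EReal.real_coe_toENNReal]

end Expect

/-- An extended-real function which is convex on `[-1, 1]`, is bounded below by a real number, and
whose endpoint values average to at most `c` has expectation at most `c` under mean-zero laws. -/
theorem measurable_and_expect_le_of_convex {φ : ℝ → EReal} {c : EReal} {m : ℝ}
    (hconv : ∀ α ∈ Set.Icc (-1 : ℝ) 1, ∀ β ∈ Set.Icc (-1 : ℝ) 1, ∀ a b : ℝ, 0 ≤ a → 0 ≤ b →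
      a + b = 1 → φ (a * α + b * β) ≤ (a : EReal) * φ α + (b : EReal) * φ β)
    (hc : ((1 / 2 : ℝ) : EReal) * φ 1 + ((1 / 2 : ℝ) : EReal) * φ (-1) ≤ c)
    (hm : ∀ α ∈ Set.Icc (-1 : ℝ) 1, (m : EReal) ≤ φ α) :
    Measurable (fun α : Set.Icc (-1 : ℝ) 1 => φ α) ∧
    ∀ p : ProbabilityMeasure (Set.Icc (-1 : ℝ) 1),
      ∫ α : Set.Icc (-1 : ℝ) 1, (α : ℝ) ∂(p : Measure (Set.Icc (-1 : ℝ) 1)) = 0 →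
      expect (p : Measure (Set.Icc (-1 : ℝ) 1)) (fun α => φ α) ≤ c := by
  have hmeas : Measurable (fun α : Set.Icc (-1 : ℝ) 1 => φ α) := by
    refine measurable_of_Iic fun r => ?_
    -- Sublevel sets of a convex function are order-connected, hence Borel.
    refine Set.OrdConnected.measurableSet ⟨fun x hx y hy z hz => ?_⟩
    obtain ⟨hxz, hzy⟩ := hz
    change φ z ≤ r
    have hx' : φ x ≤ r := hx
    have hy' : φ y ≤ r := hy
    have hxz' : (x : ℝ) ≤ z := hxz
    have hzy' : (z : ℝ) ≤ y := hzy
    rcases hxz'.eq_or_lt with h | h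
    · rwa [← h]
    have hd : (0 : ℝ) < y - x := by linarith
    have ha : 0 ≤ ((y : ℝ) - z) / (y - x) := div_nonneg (by linarith) hd.le
    have hb : 0 ≤ ((z : ℝ) - x) / (y - x) := div_nonneg (by linarith) hd.le
    have hab : ((y : ℝ) - z) / (y - x) + ((z : ℝ) - x) / (y - x) = 1 := by
      field_simp; ring
    have key := hconv x x.2 y y.2 _ _ ha hb hab
    have hz : ((y : ℝ) - z) / (y - x) * x + ((z : ℝ) - x) / (y - x) * y = z := by
      field_simp; ring
    rw [hz] at key
    refine key.trans ((add_le_add (mul_le_mul_of_nonneg_left hx' (by exact_mod_cast ha))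
      (mul_le_mul_of_nonneg_left hy' (by exact_mod_cast hb))).trans (le_of_eq ?_))
    rw [← EReal.right_distrib_of_nonneg (by exact_mod_cast ha) (by exact_mod_cast hb),
      ← EReal.coe_add, hab]
    simp
  refine ⟨hmeas, fun p hp => ?_⟩
  rcases eq_or_ne c ⊤ with rfl | hctop
  · exact le_top
  have hbot : ∀ α ∈ Set.Icc (-1 : ℝ) 1, φ α ≠ ⊥ := fun α hα h =>
    absurd (hm α hα) (by rw [h]; simp)
  have e₁ : (1 : ℝ) ∈ Set.Icc (-1 : ℝ) 1 := by constructor <;> norm_num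
  have e₂ : (-1 : ℝ) ∈ Set.Icc (-1 : ℝ) 1 := by constructor <;> norm_num
  have hhalf : (0 : ℝ) < 1 / 2 := by norm_num
  have hne : ((1 / 2 : ℝ) : EReal) * φ 1 + ((1 / 2 : ℝ) : EReal) * φ (-1) ≠ ⊤ :=
    fun h => hctop (top_le_iff.1 (h ▸ hc))
  -- With ⊥ excluded by the lower bound, a finite average forces both endpoint values to be finite.
  have hA : φ 1 ≠ ⊤ := by
    intro h
    rw [h, EReal.coe_mul_top_of_pos hhalf] at hne
    refine hne (EReal.top_add_of_ne_bot ?_)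
    induction hB : φ (-1) with
    | bot => exact absurd hB (hbot _ e₂)
    | coe B => rw [← EReal.coe_mul]; exact EReal.coe_ne_bot _
    | top => rw [EReal.coe_mul_top_of_pos hhalf]; simp
  have hB : φ (-1) ≠ ⊤ := by
    intro h
    rw [h, EReal.coe_mul_top_of_pos hhalf] at hne
    refine hne (EReal.add_top_of_ne_bot ?_)
    rw [← EReal.coe_toReal hA (hbot _ e₁), ← EReal.coe_mul]
    exact EReal.coe_ne_bot _
  lift φ 1 to ℝ using ⟨hA, hbot _ e₁⟩ with A hAe
  lift φ (-1) to ℝ using ⟨hB, hbot _ e₂⟩ with B hBe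
  -- The chord is affine in α, so its mean under a mean-zero law is its value at 0, the average of
  -- the endpoint values.
  have hchord : ∀ α : Set.Icc (-1 : ℝ) 1,
      φ α ≤ (((1 + α) / 2 * A + (1 - α) / 2 * B : ℝ) : EReal) := by
    intro α
    have h₁ := α.2.1
    have h₂ := α.2.2
    have key := hconv 1 e₁ (-1) e₂ ((1 + α) / 2) ((1 - α) / 2) (by linarith) (by linarith) (by ring)
    rw [← hAe, ← hBe, show (1 + (α : ℝ)) / 2 * 1 + (1 - (α : ℝ)) / 2 * (-1) = α by ring] at key
    exact_mod_cast key
  have hint : Integrable (fun α : Set.Icc (-1 : ℝ) 1 => (α : ℝ))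
      (p : Measure (Set.Icc (-1 : ℝ) 1)) :=
    Integrable.of_bound measurable_subtype_coe.aestronglyMeasurable 1
      (Filter.Eventually.of_forall fun α => by
        rw [Real.norm_eq_abs]; exact abs_le.2 ⟨α.2.1, α.2.2⟩)
  have hL : (fun α : Set.Icc (-1 : ℝ) 1 => (1 + (α : ℝ)) / 2 * A + (1 - (α : ℝ)) / 2 * B)
      = fun α : Set.Icc (-1 : ℝ) 1 => (A + B) / 2 + (A - B) / 2 * (α : ℝ) := by
    funext α; ring
  have hLint : Integrable (fun α : Set.Icc (-1 : ℝ) 1 => (A + B) / 2 + (A - B) / 2 * (α : ℝ))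
      (p : Measure (Set.Icc (-1 : ℝ) 1)) := (integrable_const _).add (hint.const_mul _)
  calc expect (p : Measure (Set.Icc (-1 : ℝ) 1)) (fun α => φ α)
      ≤ expect (p : Measure (Set.Icc (-1 : ℝ) 1))
        (fun α => (((A + B) / 2 + (A - B) / 2 * (α : ℝ) : ℝ) : EReal)) := by
        refine expect_mono_ae (Filter.Eventually.of_forall fun α => (hchord α).trans (le_of_eq ?_))
        congr 1; ring
    _ = (((A + B) / 2 : ℝ) : EReal) := by
        rw [expect_coe hLint, integral_add (integrable_const _) (hint.const_mul _),
          integral_const_mul, hp]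
        simp
    _ ≤ c := by
        refine (le_of_eq ?_).trans hc
        rw [← EReal.coe_mul, ← EReal.coe_mul, ← EReal.coe_add]
        congr 1; ring

/-! ### Convexity on the line -/

/-- A convex 1-Lipschitz function on a set of reals has a subgradient in `[-1, 1]` at each point. -/
theorem exists_subgradient {K : Set ℝ} {f : ℝ → ℝ} (hf : ConvexOn ℝ K f)
    (hL : LipschitzOnWith 1 f K) {g : ℝ} (hg : g ∈ K) :
    ∃ δ ∈ Set.Icc (-1 : ℝ) 1, ∀ c ∈ K, f g - f c ≤ δ * (g - c) := by
  have lip : ∀ x ∈ K, ∀ y ∈ K, |f x - f y| ≤ |x - y| := fun x hx y hy => by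
    simpa [Real.dist_eq] using hL.dist_le_mul x hx y hy
  -- δ separates left slopes from right slopes. Inserting -1 and 1 keeps it in [-1, 1]; the
  -- Lipschitz bound makes them compatible with the slopes.
  obtain ⟨δ, h₁, h₂⟩ := exists_between_sets
    (A := insert (-1) {r | ∃ c ∈ K, c < g ∧ r = (f g - f c) / (g - c)})
    (B := insert 1 {r | ∃ c ∈ K, g < c ∧ r = (f c - f g) / (c - g)})
    ⟨_, Set.mem_insert _ _⟩ ⟨_, Set.mem_insert _ _⟩ (by
      rintro a (rfl | ⟨c, hc, hcg, rfl⟩) b (rfl | ⟨e, he, hge, rfl⟩)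
      · norm_num
      · rw [le_div_iff₀ (by linarith)]
        have := (abs_le.1 (lip e he g hg)).1
        rw [abs_of_pos (by linarith)] at this
        linarith
      · rw [div_le_iff₀ (by linarith)]
        have := (abs_le.1 (lip g hg c hc)).2
        rw [abs_of_pos (by linarith)] at this
        linarith
      · exact hf.slope_mono_adjacent hc he hcg hge)
  refine ⟨δ, ⟨h₁ _ (Set.mem_insert _ _), h₂ _ (Set.mem_insert _ _)⟩, fun c hc => ?_⟩
  rcases lt_trichotomy c g with h | rfl | h
  · have := h₁ _ (Set.mem_insert_of_mem _ ⟨c, hc, h, rfl⟩)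
    rwa [div_le_iff₀ (by linarith)] at this
  · simp
  · have := h₂ _ (Set.mem_insert_of_mem _ ⟨c, hc, h, rfl⟩)
    rw [le_div_iff₀ (by linarith)] at this
    linarith

/-- If every two of the half-planes `θ ↦ θ A + (1 - θ) B ≤ 0` satisfy the dual condition, then all
of them share a point of `[0, 1]`. -/
theorem exists_common_weight {ι : Type*} (A B : ι → ℝ)
    (h : ∀ i j, ∀ θ ∈ Set.Icc (0 : ℝ) 1,
      θ * A i + (1 - θ) * A j ≤ 0 ∨ θ * B i + (1 - θ) * B j ≤ 0) :
    ∃ θ ∈ Set.Icc (0 : ℝ) 1, ∀ i, θ * A i + (1 - θ) * B i ≤ 0 := by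
  have h1 : ∀ i, A i ≤ 0 ∨ B i ≤ 0 := fun i => by simpa using h i i 1 (by simp)
  obtain ⟨θ, h₁, h₂⟩ := exists_between_sets
    (A := insert 0 {r | ∃ i, 0 < B i ∧ r = B i / (B i - A i)})
    (B := insert 1 {r | ∃ i, 0 < A i ∧ r = -B i / (A i - B i)})
    ⟨_, Set.mem_insert _ _⟩ ⟨_, Set.mem_insert _ _⟩ (by
      rintro a (rfl | ⟨j, hj, rfl⟩) b (rfl | ⟨i, hi, rfl⟩)
      · norm_num
      · have hB : B i ≤ 0 := (h1 i).resolve_left (by linarith)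
        exact div_nonneg (by linarith) (by linarith)
      · have hA : A j ≤ 0 := (h1 j).resolve_right (by linarith)
        rw [div_le_one (by linarith)]
        linarith
      · have hB : B i ≤ 0 := (h1 i).resolve_left (by linarith)
        have hA : A j ≤ 0 := (h1 j).resolve_right (by linarith)
        rw [div_le_div_iff₀ (by linarith) (by linarith)]
        -- If the lower bound on θ from j exceeded the upper bound from i, the weight below would
        -- give the A-mixture and the B-mixture the same positive value, against `h`.
        by_contra! hcon
        have hgap : 0 < A i * B j - B i * A j := by linarith
        have hs : 0 < (B j - A j) + (A i - B i) := by linarith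
        have hw : 1 - (B j - A j) / ((B j - A j) + (A i - B i))
            = (A i - B i) / ((B j - A j) + (A i - B i)) := by
          field_simp; ring
        have hmem : (B j - A j) / ((B j - A j) + (A i - B i)) ∈ Set.Icc (0 : ℝ) 1 :=
          ⟨div_nonneg (by linarith) hs.le, by rw [div_le_one hs]; linarith⟩
        have hpos := div_pos hgap hs
        rcases h i j _ hmem with h' | h'
        · rw [hw] at h'
          have : (B j - A j) / ((B j - A j) + (A i - B i)) * A i
              + (A i - B i) / ((B j - A j) + (A i - B i)) * A j
              = (A i * B j - B i * A j) / ((B j - A j) + (A i - B i)) := by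
            field_simp; ring
          linarith
        · rw [hw] at h'
          have : (B j - A j) / ((B j - A j) + (A i - B i)) * B i
              + (A i - B i) / ((B j - A j) + (A i - B i)) * B j
              = (A i * B j - B i * A j) / ((B j - A j) + (A i - B i)) := by
            field_simp; ring
          linarith)
  have hθ : θ ∈ Set.Icc (0 : ℝ) 1 := ⟨h₁ _ (Set.mem_insert _ _), h₂ _ (Set.mem_insert _ _)⟩
  refine ⟨θ, hθ, fun i => ?_⟩
  rcases lt_or_ge 0 (B i) with hB | hB
  · have hA : A i ≤ 0 := (h1 i).resolve_right (by linarith)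
    have := h₁ _ (Set.mem_insert_of_mem _ ⟨i, hB, rfl⟩)
    rw [div_le_iff₀ (by linarith)] at this
    linarith
  · rcases lt_or_ge 0 (A i) with hA | hA
    · have := h₂ _ (Set.mem_insert_of_mem _ ⟨i, hA, rfl⟩)
      rw [le_div_iff₀ (by linarith)] at this
      linarith
    · have := mul_nonneg hθ.1 (neg_nonneg.2 hA)
      have := mul_nonneg (sub_nonneg.2 hθ.2) (neg_nonneg.2 hB)
      linarith

/-- The points of a compact set of reals next to a given point `g` of its convex hull. -/
theorem exists_adjacent {Y : Set ℝ} (hY : IsCompact Y) {g : ℝ} (h₁ : ∃ u ∈ Y, u ≤ g)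
    (h₂ : ∃ u ∈ Y, g ≤ u) :
    ∃ a ∈ Y, ∃ b ∈ Y, a ≤ g ∧ g ≤ b ∧ ∀ u ∈ Y, u ≤ a ∨ b ≤ u := by
  obtain ⟨u₁, hu₁, hug⟩ := h₁
  obtain ⟨u₂, hu₂, hgu⟩ := h₂
  obtain ⟨a, ha, hamax⟩ := (hY.inter_right isClosed_Iic).exists_isGreatest (s := Y ∩ Set.Iic g)
    ⟨u₁, hu₁, hug⟩
  obtain ⟨b, hb, hbmin⟩ := (hY.inter_right isClosed_Ici).exists_isLeast (s := Y ∩ Set.Ici g)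
    ⟨u₂, hu₂, hgu⟩
  refine ⟨a, ha.1, b, hb.1, ha.2, hb.2, fun u hu => ?_⟩
  rcases le_total u g with h | h
  · exact Or.inl (hamax ⟨hu, h⟩)
  · exact Or.inr (hbmin ⟨hu, h⟩)

/-! ### Admissible losses: randomized predictions and the absolute loss -/

theorem mem_convexHull_of_mem_Icc {Y : Set ℝ} (hYpos : (1 : ℝ) ∈ Y) (hYneg : (-1 : ℝ) ∈ Y) {g : ℝ}
    (hg : g ∈ Set.Icc (-1 : ℝ) 1) : g ∈ convexHull ℝ Y :=
  (convex_convexHull ℝ Y).ordConnected.out (subset_convexHull ℝ Y hYneg)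
    (subset_convexHull ℝ Y hYpos) hg

/-- For an admissible loss every prediction in `[-1, 1]` is matched, whatever the label, by a
randomized prediction in `Y`. -/
theorem exists_randomized_prediction {Y : Set ℝ} (hY : IsCompact Y) (hYpos : (1 : ℝ) ∈ Y)
    (hYneg : (-1 : ℝ) ∈ Y) {ℓ : ℝ → ℝ → ℝ} (hℓ : IsAdmissibleLoss Y ℓ) {g : ℝ}
    (hg : g ∈ Set.Icc (-1 : ℝ) 1) :
    ∃ q : ProbabilityMeasure Y, ∀ y : Y, ∫ u : Y, ℓ u y ∂(q : Measure Y) ≤ ℓ g y := by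
  obtain ⟨a, ha, b, hb, hag, hgb, hadj⟩ := exists_adjacent hY ⟨-1, hYneg, hg.1⟩ ⟨1, hYpos, hg.2⟩
  have hK : ∀ u ∈ Y, u ∈ convexHull ℝ Y := fun u hu => subset_convexHull ℝ Y hu
  have hgK := mem_convexHull_of_mem_Icc hYpos hYneg hg
  -- Duality reduces the claim to laws on two labels. Such a law has an optimal u in Y, which lies
  -- outside the gap (a, b); by convexity the neighbour between u and g is no worse than g.
  obtain ⟨θ, hθ, hq⟩ := exists_common_weight (fun y : Y => ℓ a y - ℓ g y)
    (fun y : Y => ℓ b y - ℓ g y) (by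
      intro y₁ y₂ θ hθ
      obtain ⟨u, hu, hmin⟩ := hℓ.argmin_mem (twoPoint ⟨θ, hθ⟩ y₁ y₂)
      have hle := hmin g (integrable_twoPoint _ _ _ _)
      rw [integral_twoPoint, integral_twoPoint] at hle
      have hconv : ConvexOn ℝ (convexHull ℝ Y) (fun v => θ * ℓ v y₁ + (1 - θ) * ℓ v y₂) :=
        ((hℓ.convex y₁ y₁.2).smul hθ.1).add ((hℓ.convex y₂ y₂.2).smul (sub_nonneg.2 hθ.2))
      dsimp only at hle ⊢
      rcases hadj u hu with h | h
      · left
        have := hconv.le_max_of_mem_Icc (hK u hu) hgK ⟨h, hag⟩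
        rw [max_eq_right hle] at this
        linarith
      · right
        have := hconv.le_max_of_mem_Icc hgK (hK u hu) ⟨hgb, h⟩
        rw [max_eq_left hle] at this
        linarith)
  refine ⟨twoPoint ⟨θ, hθ⟩ ⟨a, ha⟩ ⟨b, hb⟩, fun y => ?_⟩
  rw [integral_twoPoint]
  have := hq y
  dsimp only at this ⊢
  linarith

theorem integrable_abs_sub {Y : Set ℝ} (hY : IsCompact Y) (p : Measure Y) [IsFiniteMeasure p]
    (v : ℝ) : Integrable (fun y : Y => |(y : ℝ) - v|) p := by
  obtain ⟨C, hC⟩ := hY.isBounded.exists_norm_le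
  refine Integrable.of_bound (by fun_prop) (C + |v|) (Filter.Eventually.of_forall fun y => ?_)
  have := hC y y.2
  rw [Real.norm_eq_abs] at this ⊢
  rw [abs_abs]
  exact (abs_sub _ _).trans (by linarith)

theorem isAdmissibleLoss_abs {Y : Set ℝ} (hY : IsCompact Y) (hne : Y.Nonempty) :
    IsAdmissibleLoss Y (fun u y => |u - y|) where
  convex y _ := by
    have : ConvexOn ℝ (convexHull ℝ Y) (fun u : ℝ => dist u y) :=
      convexOn_dist y (convex_convexHull ℝ Y)
    simpa only [Real.dist_eq] using this
  lipschitz y _ := by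
    refine LipschitzOnWith.of_dist_le_mul fun u _ v _ => ?_
    simp only [Real.dist_eq, NNReal.coe_one, one_mul]
    refine (abs_abs_sub_abs_le_abs_sub _ _).trans (le_of_eq ?_)
    congr 1; ring
  bounded := by
    obtain ⟨C, hC⟩ := hY.isBounded.exists_norm_le
    refine ⟨C + C, fun u hu y hy => ?_⟩
    rw [abs_abs]
    exact (abs_sub _ _).trans (add_le_add (hC u hu) (hC y hy))
  measurable u := by fun_prop
  argmin_mem p := by
    have hcomm : ∀ v : ℝ, Integrable (fun y : Y => |v - y|) (p : Measure Y) := fun v => by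
      simpa only [abs_sub_comm] using integrable_abs_sub hY (p : Measure Y) v
    have hcont : Continuous fun v : ℝ => ∫ y : Y, |v - y| ∂(p : Measure Y) := by
      refine (LipschitzWith.of_dist_le_mul (K := 1) fun u v => ?_).continuous
      rw [Real.dist_eq, Real.dist_eq, ← integral_sub (hcomm u) (hcomm v), NNReal.coe_one, one_mul]
      have hbd : ∀ y : Y, ‖|u - (y : ℝ)| - |v - y|‖ ≤ |u - v| := fun y => by
        refine (abs_abs_sub_abs_le_abs_sub _ _).trans (le_of_eq ?_)
        congr 1; ring
      have := norm_integral_le_of_norm_le_const (μ := (p : Measure Y))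
        (Filter.Eventually.of_forall hbd)
      simpa using this
    obtain ⟨u, hu, hmin⟩ := hY.exists_isMinOn hne hcont.continuousOn
    refine ⟨u, hu, fun v _ => ?_⟩
    -- Between neighbours a, b of Y each `|· - y|` with y in Y is affine, so v is matched by a
    -- mixture of a and b. Beyond Y, the nearest extreme point of Y is better.
    have hdom : ∃ a ∈ Y, ∃ b ∈ Y, ∃ θ ∈ Set.Icc (0 : ℝ) 1, ∀ y ∈ Y,
        θ * |a - y| + (1 - θ) * |b - y| ≤ |v - y| := by
      by_cases h₁ : ∃ u ∈ Y, u ≤ v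
      · by_cases h₂ : ∃ u ∈ Y, v ≤ u
        · obtain ⟨a, ha, b, hb, hav, hvb, hadj⟩ := exists_adjacent hY h₁ h₂
          rcases hav.eq_or_lt with rfl | hav
          · exact ⟨a, ha, a, ha, 1, by simp, fun y _ => by simp⟩
          have hd : 0 < b - a := by linarith
          refine ⟨a, ha, b, hb, (b - v) / (b - a),
            ⟨div_nonneg (by linarith) hd.le, by rw [div_le_one hd]; linarith⟩, fun y hy => ?_⟩
          have hw : 1 - (b - v) / (b - a) = (v - a) / (b - a) := by field_simp; ring
          rw [hw]
          rcases hadj y hy with h | h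
          · rw [abs_of_nonneg (by linarith), abs_of_nonneg (by linarith),
              abs_of_nonneg (by linarith)]
            refine le_of_eq ?_
            field_simp; ring
          · rw [abs_of_nonpos (by linarith), abs_of_nonpos (by linarith),
              abs_of_nonpos (by linarith)]
            refine le_of_eq ?_
            field_simp; ring
        · push Not at h₂
          obtain ⟨b, hb, hbmax⟩ := hY.exists_isGreatest hne
          refine ⟨b, hb, b, hb, 1, by simp, fun y hy => ?_⟩
          have := h₂ b hb
          have := hbmax hy
          rw [abs_of_nonneg (by linarith), abs_of_nonneg (by linarith)]
          linarith
      · push Not at h₁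
        obtain ⟨b, hb, hbmin⟩ := hY.exists_isLeast hne
        refine ⟨b, hb, b, hb, 1, by simp, fun y hy => ?_⟩
        have := h₁ b hb
        have := hbmin hy
        rw [abs_of_nonpos (by linarith), abs_of_nonpos (by linarith)]
        linarith
    obtain ⟨a, ha, b, hb, θ, hθ, hle⟩ := hdom
    have hint := integral_mono (((hcomm a).const_mul θ).add ((hcomm b).const_mul (1 - θ)))
      (hcomm v) (fun y : Y => hle y y.2)
    rw [integral_add' ((hcomm a).const_mul θ) ((hcomm b).const_mul (1 - θ)), integral_const_mul,
      integral_const_mul] at hint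
    have h₁ := mul_le_mul_of_nonneg_left (isMinOn_iff.1 hmin a ha) hθ.1
    have h₂ := mul_le_mul_of_nonneg_left (isMinOn_iff.1 hmin b hb) (sub_nonneg.2 hθ.2)
    linarith

/-! ### Strategies of the adversary -/

/-- A finite binary tree with inner nodes labelled by `X` and leaves labelled by `W`. The adversary
walks down the tree, choosing the branch by a fair coin. -/
inductive SignTree {d : ℕ} (X W : Set (EuclideanSpace ℝ (Fin d))) : Type
  | leaf (w : W) : SignTree X W
  | node (x : X) (l r : SignTree X W) : SignTree X W

namespace SignTree

variable {d : ℕ} {S : Type*} [AddCommGroup S] {X W : Set (EuclideanSpace ℝ (Fin d))}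

/-- The expectation of `⟨w, v + ∑ ε x⟩ - F (s + ∑ T̄ x)` along a random path. -/
def payoff (Tbar : X → S) (F : S → ℝ) : SignTree X W → EuclideanSpace ℝ (Fin d) → S → ℝ
  | leaf w, v, s => inner ℝ (w : EuclideanSpace ℝ (Fin d)) v - F s
  | node x l r, v, s =>
      (payoff Tbar F l (v + x) (s + Tbar x) + payoff Tbar F r (v - x) (s + Tbar x)) / 2

/-- The gradient of the payoff in `v`. -/
def gradient : SignTree X W → EuclideanSpace ℝ (Fin d)
  | leaf w => w
  | node _ l r => (1 / 2 : ℝ) • gradient l + (1 / 2 : ℝ) • gradient r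

def height : SignTree X W → ℕ
  | leaf _ => 0
  | node _ l r => max l.height r.height + 1

variable (Tbar : X → S) (F : S → ℝ)

/-- The vector v enters only through the inner products at the leaves, so the payoff is affine in v
with slope independent of v and s. -/
theorem payoff_add (t : SignTree X W) (v u : EuclideanSpace ℝ (Fin d)) (s : S) :
    t.payoff Tbar F (v + u) s = t.payoff Tbar F v s + inner ℝ t.gradient u := by
  induction t generalizing v s with
  | leaf w => simp only [payoff, gradient, inner_add_right]; ring
  | node x l r ihl ihr =>
    simp only [payoff, gradient, inner_add_left, real_inner_smul_left]
    rw [add_right_comm, ihl, add_sub_right_comm, ihr]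
    ring

theorem payoff_sub_smul (t : SignTree X W) (v x : EuclideanSpace ℝ (Fin d)) (s : S) (δ : ℝ) :
    t.payoff Tbar F (v - δ • x) s = t.payoff Tbar F v s - δ * inner ℝ t.gradient x := by
  rw [sub_eq_add_neg, ← neg_smul, payoff_add, real_inner_smul_right]
  ring

/-- The gradient is a convex combination of leaf labels, so linear bounds on W pass to it. -/
theorem inner_gradient_le {u : EuclideanSpace ℝ (Fin d)} {C : ℝ}
    (h : ∀ w ∈ W, inner ℝ w u ≤ C) (t : SignTree X W) : inner ℝ t.gradient u ≤ C := by
  induction t with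
  | leaf w => exact h w w.2
  | node x l r ihl ihr =>
    simp only [gradient, inner_add_left, real_inner_smul_left]
    linarith

/-- Each leaf changes by at most C, and averaging preserves this. σ has to stay a sum of values of
`Tbar`, since only there is F controlled. -/
theorem payoff_le_of_le_add {s : S} {C : ℝ} (hF : ∀ (m : ℕ) (x : Fin m → X),
      F (∑ t, Tbar (x t)) ≤ F (s + ∑ t, Tbar (x t)) + C)
    (t : SignTree X W) (v : EuclideanSpace ℝ (Fin d)) {σ : S}
    (hσ : ∃ (m : ℕ) (x : Fin m → X), σ = ∑ t, Tbar (x t)) :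
    t.payoff Tbar F v (s + σ) ≤ t.payoff Tbar F v σ + C := by
  induction t generalizing v σ with
  | leaf w =>
    obtain ⟨m, x, rfl⟩ := hσ
    have := hF m x
    simp only [payoff]
    linarith
  | node x l r ihl ihr =>
    obtain ⟨m, z, rfl⟩ := hσ
    have hσ' : ∃ (k : ℕ) (y : Fin k → X),
        (∑ t, Tbar (z t)) + Tbar x = ∑ t, Tbar (y t) :=
      ⟨m + 1, Fin.snoc z x, by simp [Fin.sum_univ_castSucc]⟩
    have h₁ := ihl (v + x) hσ'
    have h₂ := ihr (v - x) hσ'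
    simp only [payoff, add_assoc] at h₁ h₂ ⊢
    linarith

end SignTree

variable {d : ℕ} {S : Type*} [AddCommGroup S] {X W : Set (EuclideanSpace ℝ (Fin d))} {Y : Set ℝ}
  {Tbar : X → S} {F : S → ℝ}

/-- No strategy of the adversary has a positive payoff. -/
def NonposPayoff (X W : Set (EuclideanSpace ℝ (Fin d))) (Tbar : X → S) (F : S → ℝ) : Prop :=
  ∀ t : SignTree X W, t.payoff Tbar F 0 0 ≤ 0

/-! ### Burkholder functions dominate the payoffs -/

/-- A majorant of `V` which decreases on average under Rademacher steps dominates all payoffs. -/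
theorem add_payoff_le_of_rademacher {U : ℝ × EuclideanSpace ℝ (Fin d) × S → EReal}
    (hYpos : (1 : ℝ) ∈ Y) (hV : ∀ τ, natV W F τ ≤ U τ)
    (hU : ∀ τ (z : X × Y) (r₁ r₂ : ℝ), (r₁ : EReal) ≤ U (τ + natT X Y Tbar z 1) →
      (r₂ : EReal) ≤ U (τ + natT X Y Tbar z (-1)) → (((r₁ + r₂) / 2 : ℝ) : EReal) ≤ U τ)
    (t : SignTree X W) (a : ℝ) (v : EuclideanSpace ℝ (Fin d)) (s : S) :
    ((a + t.payoff Tbar F v s : ℝ) : EReal) ≤ U (a, v, s) := by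
  induction t generalizing a v s with
  | leaf w =>
    refine le_trans ?_ (hV (a, v, s))
    simp only [natV, SignTree.payoff]
    rw [← add_sub_assoc, EReal.coe_sub, EReal.coe_add]
    exact EReal.sub_le_sub (add_le_add le_rfl
      (le_iSup (fun w : W => ((inner ℝ (w : EuclideanSpace ℝ (Fin d)) v : ℝ) : EReal)) w)) le_rfl
  | node x l r ihl ihr =>
    have h₁ := ihl (a + 1) (v + x) (s + Tbar x)
    have h₂ := ihr (a - 1) (v - x) (s + Tbar x)
    -- With ŷ = 1 the first coordinate moves to a ± 1, which averages back to a.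
    have e₁ : (a, v, s) + natT X Y Tbar (x, ⟨1, hYpos⟩) 1 = (a + 1, v + x, s + Tbar x) := by
      simp [natT]
    have e₂ : (a, v, s) + natT X Y Tbar (x, ⟨1, hYpos⟩) (-1) = (a - 1, v - x, s + Tbar x) := by
      simp [natT, sub_eq_add_neg]
    refine le_trans (le_of_eq ?_) (hU (a, v, s) (x, ⟨1, hYpos⟩) _ _ (e₁ ▸ h₁) (e₂ ▸ h₂))
    simp only [SignTree.payoff]
    congr 1; ring

theorem IsConvexBurkholder.add_payoff_le {U : ℝ × EuclideanSpace ℝ (Fin d) × S → EReal}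
    (hYpos : (1 : ℝ) ∈ Y) (hU : IsConvexBurkholder (natT X Y Tbar) (natV W F) U)
    (t : SignTree X W) (a : ℝ) (v : EuclideanSpace ℝ (Fin d)) (s : S) :
    ((a + t.payoff Tbar F v s : ℝ) : EReal) ≤ U (a, v, s) := by
  refine add_payoff_le_of_rademacher hYpos hU.majorant (fun τ z r₁ r₂ h₁ h₂ => ?_) t a v s
  refine le_trans ?_ (hU.rademacher τ z)
  have hhalf : (0 : EReal) ≤ ((1 / 2 : ℝ) : EReal) := by
    exact_mod_cast (by norm_num : (0 : ℝ) ≤ 1 / 2)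
  refine le_trans (le_of_eq ?_) (add_le_add (mul_le_mul_of_nonneg_left h₁ hhalf)
    (mul_le_mul_of_nonneg_left h₂ hhalf))
  rw [← EReal.coe_mul, ← EReal.coe_mul, ← EReal.coe_add]
  congr 1; ring

theorem IsBurkholder.add_payoff_le {U : ℝ × EuclideanSpace ℝ (Fin d) × S → EReal}
    (hYpos : (1 : ℝ) ∈ Y) (hU : IsBurkholder (natT X Y Tbar) (natV W F) U)
    (t : SignTree X W) (a : ℝ) (v : EuclideanSpace ℝ (Fin d)) (s : S) :
    ((a + t.payoff Tbar F v s : ℝ) : EReal) ≤ U (a, v, s) := by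
  refine add_payoff_le_of_rademacher hYpos hU.majorant (fun τ z r₁ r₂ h₁ h₂ => ?_) t a v s
  have e₁ : (1 : ℝ) ∈ Set.Icc (-1 : ℝ) 1 := by constructor <;> norm_num
  have e₂ : (-1 : ℝ) ∈ Set.Icc (-1 : ℝ) 1 := by constructor <;> norm_num
  let p := twoPoint ⟨1 / 2, by norm_num, by norm_num⟩ (⟨1, e₁⟩ : Set.Icc (-1 : ℝ) 1) ⟨-1, e₂⟩
  refine le_trans ?_ (hU.concave τ z p (by rw [integral_twoPoint]; norm_num))
  -- The coin charges only ±1, so the affine interpolation of r₁ and r₂ is almost surely a minorant;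
  -- it is real and integrable.
  have hmono : ∀ᵐ α : Set.Icc (-1 : ℝ) 1 ∂(p : Measure (Set.Icc (-1 : ℝ) 1)),
      (((r₁ + r₂) / 2 + (r₁ - r₂) / 2 * (α : ℝ) : ℝ) : EReal) ≤ U (τ + natT X Y Tbar z α) := by
    refine ae_twoPoint _ _ _ ?_ ?_
    · refine le_trans (le_of_eq ?_) h₁
      congr 1; ring
    · refine le_trans (le_of_eq ?_) h₂
      congr 1; ring
  refine le_trans (le_of_eq ?_) (expect_mono_ae hmono)
  rw [expect_coe (integrable_twoPoint _ _ _ _), integral_twoPoint]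
  congr 1; ring

theorem nonposPayoff_of_add_payoff_le {U : ℝ × EuclideanSpace ℝ (Fin d) × S → EReal}
    (h₀ : U 0 ≤ 0) (h : ∀ (t : SignTree X W) a v s,
      ((a + t.payoff Tbar F v s : ℝ) : EReal) ≤ U (a, v, s)) : NonposPayoff X W Tbar F := by
  intro t
  have := (h t 0 0 0).trans h₀
  rw [zero_add] at this
  exact_mod_cast this

/-! ### The least Burkholder function -/

/-- The value of the game, as a supremum over the strategies of the adversary. -/
def leastU (W : Set (EuclideanSpace ℝ (Fin d))) (Tbar : X → S) (F : S → ℝ) :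
    ℝ × EuclideanSpace ℝ (Fin d) × S → EReal :=
  fun τ => ⨆ t : SignTree X W, ((τ.1 + t.payoff Tbar F τ.2.1 τ.2.2 : ℝ) : EReal)

theorem leastU_le_coe {τ : ℝ × EuclideanSpace ℝ (Fin d) × S} {c : ℝ} :
    leastU W Tbar F τ ≤ c ↔ ∀ t : SignTree X W, τ.1 + t.payoff Tbar F τ.2.1 τ.2.2 ≤ c := by
  simp only [leastU, iSup_le_iff, EReal.coe_le_coe_iff]

/-- Trees consisting of a single leaf already produce V. Testing against real upper bounds c avoids
arithmetic with infinite values. -/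
theorem natV_le_leastU (τ : ℝ × EuclideanSpace ℝ (Fin d) × S) :
    natV W F τ ≤ leastU W Tbar F τ := by
  obtain ⟨a, v, s⟩ := τ
  refine EReal.le_of_forall_lt_iff_le.1 fun c hc => ?_
  have h := leastU_le_coe.1 hc.le
  have hsup : (⨆ w : W, ((inner ℝ (w : EuclideanSpace ℝ (Fin d)) v : ℝ) : EReal))
      ≤ ((c - a + F s : ℝ) : EReal) := by
    refine iSup_le fun w => EReal.coe_le_coe_iff.2 ?_
    have := h (SignTree.leaf w)
    simp only [SignTree.payoff] at this
    linarith
  refine (EReal.sub_le_sub (add_le_add le_rfl hsup) le_rfl).trans (le_of_eq ?_)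
  rw [← EReal.coe_add, ← EReal.coe_sub]
  congr 1; ring

/-- Convexity holds because a supremum of affine functions is convex; the Rademacher inequality
holds because continuations after +1 and -1 combine into one tree. -/
theorem isConvexBurkholder_leastU (hW : W.Nonempty) (h : NonposPayoff X W Tbar F) :
    IsConvexBurkholder (natT X Y Tbar) (natV W F) (leastU W Tbar F) where
  zero_le := leastU_le_coe.2 fun t => by simpa using h t
  majorant := natV_le_leastU
  convex := by
    rintro ⟨a, v, s⟩ ⟨x, u⟩ α - β - p q hp hq hpq
    refine iSup_le fun t => ?_
    refine le_trans (le_of_eq ?_) (add_le_add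
      (mul_le_mul_of_nonneg_left (le_iSup _ t) (by exact_mod_cast hp))
      (mul_le_mul_of_nonneg_left (le_iSup _ t) (by exact_mod_cast hq)))
    rw [← EReal.coe_mul, ← EReal.coe_mul, ← EReal.coe_add]
    congr 1
    simp only [natT, Prod.mk_add_mk, SignTree.payoff_add, real_inner_smul_right]
    have hq' : q = 1 - p := by linarith
    subst hq'
    ring
  rademacher := by
    rintro ⟨a, v, s⟩ ⟨x, u⟩
    refine EReal.le_of_forall_lt_iff_le.1 fun c hc => ?_
    have hle := leastU_le_coe.1 hc.le
    obtain ⟨w⟩ := hW.to_subtype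
    have hpair : ∀ l r : SignTree X W,
        (a + u + l.payoff Tbar F (v + x) (s + Tbar x))
          + (a - u + r.payoff Tbar F (v - x) (s + Tbar x)) ≤ 2 * c := fun l r => by
      have := hle (SignTree.node x l r)
      simp only [SignTree.payoff] at this
      linarith
    -- A bounds the + branch and 2c - A the - branch, so the two bounds average to c.
    obtain ⟨A, hA, hB⟩ := exists_between_sets
      (A := Set.range fun l : SignTree X W => a + u + l.payoff Tbar F (v + x) (s + Tbar x))
      (B := Set.range fun r : SignTree X W =>
        2 * c - (a - u + r.payoff Tbar F (v - x) (s + Tbar x)))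
      ⟨_, SignTree.leaf w, rfl⟩ ⟨_, SignTree.leaf w, rfl⟩ (by
        rintro _ ⟨l, rfl⟩ _ ⟨r, rfl⟩
        have := hpair l r
        dsimp only
        linarith)
    have h₁ : leastU W Tbar F ((a, v, s) + natT X Y Tbar (x, u) 1) ≤ (A : EReal) :=
      leastU_le_coe.2 fun t => by simpa [natT] using hA _ ⟨t, rfl⟩
    have h₂ : leastU W Tbar F ((a, v, s) + natT X Y Tbar (x, u) (-1))
        ≤ ((2 * c - A : ℝ) : EReal) :=
      leastU_le_coe.2 fun t => by
        have := hB _ ⟨t, rfl⟩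
        simp only [natT, Prod.mk_add_mk, mul_neg, mul_one, neg_smul, one_smul, ← sub_eq_add_neg]
        linarith
    have hhalf : (0 : EReal) ≤ ((1 / 2 : ℝ) : EReal) := by
      exact_mod_cast (by norm_num : (0 : ℝ) ≤ 1 / 2)
    refine (add_le_add (mul_le_mul_of_nonneg_left h₁ hhalf)
      (mul_le_mul_of_nonneg_left h₂ hhalf)).trans (le_of_eq ?_)
    rw [← EReal.coe_mul, ← EReal.coe_mul, ← EReal.coe_add]
    congr 1; ring

/-- A single w gives an affine minorant in α, bounded on [-1, 1]. This is what excludes ⊥ when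
convexity is turned into an expectation bound. -/
theorem exists_lower_bound_natV (hW : W.Nonempty) (τ : ℝ × EuclideanSpace ℝ (Fin d) × S)
    (z : X × Y) : ∃ m : ℝ, ∀ α ∈ Set.Icc (-1 : ℝ) 1,
      (m : EReal) ≤ natV W F (τ + natT X Y Tbar z α) := by
  obtain ⟨w, hw⟩ := hW
  obtain ⟨a, v, s⟩ := τ
  obtain ⟨x, u⟩ := z
  refine ⟨a + inner ℝ w v - F (s + Tbar x) - |(u : ℝ) + inner ℝ w (x : EuclideanSpace ℝ (Fin d))|,
    fun α hα => ?_⟩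
  have hmul : -|(u : ℝ) + inner ℝ w (x : EuclideanSpace ℝ (Fin d))|
      ≤ ((u : ℝ) + inner ℝ w (x : EuclideanSpace ℝ (Fin d))) * α := by
    have h : |((u : ℝ) + inner ℝ w (x : EuclideanSpace ℝ (Fin d))) * α|
        ≤ |(u : ℝ) + inner ℝ w (x : EuclideanSpace ℝ (Fin d))| := by
      rw [abs_mul]
      exact mul_le_of_le_one_right (abs_nonneg _) (abs_le.2 hα)
    exact (abs_le.1 h).1
  simp only [natV, natT, Prod.mk_add_mk]
  refine le_trans ?_ (EReal.sub_le_sub (add_le_add le_rfl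
    (le_iSup (fun w : W => ((inner ℝ (w : EuclideanSpace ℝ (Fin d)) (v + α • (x :
      EuclideanSpace ℝ (Fin d))) : ℝ) : EReal)) ⟨w, hw⟩)) le_rfl)
  rw [← EReal.coe_add, ← EReal.coe_sub, EReal.coe_le_coe_iff]
  simp only [inner_add_right, real_inner_smul_right]
  linarith

theorem IsConvexBurkholder.isBurkholder (hW : W.Nonempty)
    {U : ℝ × EuclideanSpace ℝ (Fin d) × S → EReal}
    (hU : IsConvexBurkholder (natT X Y Tbar) (natV W F) U) :
    IsBurkholder (natT X Y Tbar) (natV W F) U := by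
  have key := fun (τ : ℝ × EuclideanSpace ℝ (Fin d) × S) (z : X × Y) =>
    measurable_and_expect_le_of_convex (φ := fun α => U (τ + natT X Y Tbar z α))
      (hU.convex τ z) (hU.rademacher τ z)
      (fun α hα => ((exists_lower_bound_natV (Y := Y) (Tbar := Tbar) (F := F) hW τ z).choose_spec
        α hα).trans (hU.majorant _))
  exact ⟨hU.zero_le, hU.majorant, fun τ z => (key τ z).1, fun τ z => (key τ z).2⟩

/-- Moving s to 0 costs C, and moving v to 0 costs at most ‖v‖ times a norm bound for W; the payoff
left at the origin is nonpositive. -/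
theorem exists_real_leastU (hW : W.Nonempty) (hWb : Bornology.IsBounded W)
    (hF : ∀ s : S, ∃ C : ℝ, ∀ (m : ℕ) (x : Fin m → X),
      F (∑ t, Tbar (x t)) ≤ F (s + ∑ t, Tbar (x t)) + C)
    (h : NonposPayoff X W Tbar F) :
    ∃ U : ℝ × EuclideanSpace ℝ (Fin d) × S → ℝ, (fun τ => (U τ : EReal)) = leastU W Tbar F := by
  refine ⟨fun τ => (leastU W Tbar F τ).toReal, funext fun τ => ?_⟩
  obtain ⟨a, v, s⟩ := τ
  obtain ⟨w⟩ := hW.to_subtype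
  obtain ⟨R, hR⟩ := hWb.exists_norm_le
  obtain ⟨C, hC⟩ := hF s
  refine EReal.coe_toReal (ne_top_of_le_ne_top (EReal.coe_ne_top (a + (R * ‖v‖ + C)))
    (leastU_le_coe.2 fun t => ?_)) (ne_bot_of_le_ne_bot (EReal.coe_ne_bot _)
      (le_iSup (fun t : SignTree X W => ((a + t.payoff Tbar F v s : ℝ) : EReal))
        (SignTree.leaf w)))
  have h₁ := t.payoff_le_of_le_add Tbar F hC v (σ := 0) ⟨0, Fin.elim0, by simp⟩
  have h₂ := t.payoff_add Tbar F 0 v 0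
  have h₃ := h t
  have h₄ := t.inner_gradient_le (u := v) (C := R * ‖v‖) fun w hw =>
    (real_inner_le_norm w v).trans (mul_le_mul_of_nonneg_right (hR w hw) (norm_nonneg v))
  rw [add_zero] at h₁
  rw [zero_add] at h₂
  dsimp only
  linarith


/-! ### The game as a recursion over lists of rounds -/

/-- The expected loss of the forecaster `q` on the rounds of the second list, which follow those of
the first one. -/
def cumLoss (ℓ : ℝ → ℝ → ℝ) (q : List (X × Y) → X → ProbabilityMeasure Y) :
    List (X × Y) → List (X × Y) → ℝ
  | _, [] => 0
  | past, z :: future =>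
      ∫ u : Y, ℓ u z.2 ∂(q past z.1 : Measure Y) + cumLoss ℓ q (past ++ [z]) future

theorem cumLoss_ofFn (ℓ : ℝ → ℝ → ℝ) (q : List (X × Y) → X → ProbabilityMeasure Y) {n : ℕ}
    (past : List (X × Y)) (x : Fin n → X) (y : Fin n → Y) :
    cumLoss ℓ q past (List.ofFn fun s => (x s, y s)) =
      ∑ t : Fin n, ∫ u : Y, ℓ u (y t)
        ∂(q (past ++ (List.ofFn fun s => (x s, y s)).take (t : ℕ)) (x t) : Measure Y) := by
  induction n generalizing past with
  | zero => simp [cumLoss]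
  | succ n ih =>
    rw [List.ofFn_succ, Fin.sum_univ_succ, cumLoss, ih (past ++ [(x 0, y 0)])
      (fun i => x i.succ) (fun i => y i.succ)]
    simp

/-- The regret bound along a list of rounds, for every competitor. -/
def RegretLE (W : Set (EuclideanSpace ℝ (Fin d))) (Tbar : X → S) (F : S → ℝ) (ℓ : ℝ → ℝ → ℝ)
    (q : List (X × Y) → X → ProbabilityMeasure Y) (rounds : List (X × Y)) : Prop :=
  ∀ w ∈ W, cumLoss ℓ q [] rounds
    - (rounds.map fun z => ℓ (inner ℝ w (z.1 : EuclideanSpace ℝ (Fin d))) z.2).sum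
      ≤ F (rounds.map fun z => Tbar z.1).sum

theorem achievable_of_regretLE (hW : W.Nonempty) {ℓ : ℝ → ℝ → ℝ}
    {q : List (X × Y) → X → ProbabilityMeasure Y} (h : ∀ rounds, RegretLE W Tbar F ℓ q rounds) :
    Achievable X W Y Tbar F ℓ := by
  have := hW.to_subtype
  refine fun n _ => ⟨q, fun x y => ?_⟩
  rw [sub_le_iff_le_add', ← sub_le_iff_le_add]
  refine le_ciInf fun w => ?_
  have := h (List.ofFn fun s => (x s, y s)) w w.2
  rw [cumLoss_ofFn] at this
  simp only [List.map_ofFn, List.sum_ofFn, Function.comp_def, List.nil_append] at this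
  linarith

theorem sum_map_eq_sum_get {A M : Type*} [AddCommMonoid M] (l : List A) (f : A → M) :
    (l.map f).sum = ∑ t : Fin l.length, f (l.get t) := by
  conv_lhs => rw [← List.ofFn_get l]
  rw [List.map_ofFn, List.sum_ofFn]
  rfl

theorem Achievable.exists_regretLE {ℓ : ℝ → ℝ → ℝ} (hℓ : ∀ u y, 0 ≤ ℓ u y)
    (h : Achievable X W Y Tbar F ℓ) {n : ℕ} (hn : 1 ≤ n) :
    ∃ q : List (X × Y) → X → ProbabilityMeasure Y, ∀ rounds, rounds.length = n →
      RegretLE W Tbar F ℓ q rounds := by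
  obtain ⟨q, hq⟩ := h n hn
  refine ⟨q, ?_⟩
  rintro rounds rfl w hw
  have key := hq (fun i => (rounds.get i).1) (fun i => (rounds.get i).2)
  have hcum := cumLoss_ofFn ℓ q [] (fun i => (rounds.get i).1) (fun i => (rounds.get i).2)
  simp only [Prod.mk.eta, List.ofFn_get, List.nil_append] at key hcum
  -- A real infimum lies below its terms only if the family is bounded below; nonnegativity of the
  -- loss ensures it.
  have hinf := ciInf_le (f := fun w : W => ∑ t : Fin rounds.length,
    ℓ (inner ℝ (w : EuclideanSpace ℝ (Fin d)) ((rounds.get t).1 : EuclideanSpace ℝ (Fin d)))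
      (rounds.get t).2) ⟨0, by
        rintro _ ⟨w, rfl⟩
        exact Finset.sum_nonneg fun t _ => hℓ _ _⟩ ⟨w, hw⟩
  rw [sum_map_eq_sum_get, sum_map_eq_sum_get, hcum]
  dsimp only at hinf
  linarith

theorem abs_inner_le_one (hWsymm : ∀ w ∈ W, -w ∈ W)
    (hXW : ∀ x ∈ X, ∀ w ∈ W, inner ℝ w x ≤ 1) {x w : EuclideanSpace ℝ (Fin d)} (hx : x ∈ X)
    (hw : w ∈ W) : inner ℝ w x ∈ Set.Icc (-1 : ℝ) 1 := by
  have := hXW x hx (-w) (hWsymm w hw)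
  rw [inner_neg_left] at this
  exact ⟨by linarith, hXW x hx w hw⟩

/-! ### Random signs force the regret of the absolute loss -/

/-- Whatever the law of the prediction, a fair random label ±1 costs at least 1 on average. -/
theorem two_le_integral_abs_add (hY : IsCompact Y) (p : ProbabilityMeasure Y) :
    2 ≤ ∫ u : Y, |(u : ℝ) - 1| ∂(p : Measure Y) + ∫ u : Y, |(u : ℝ) - (-1)| ∂(p : Measure Y) := by
  rw [← integral_add (integrable_abs_sub hY _ _) (integrable_abs_sub hY _ _)]
  have h := integral_mono (μ := (p : Measure Y)) (integrable_const (2 : ℝ))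
    ((integrable_abs_sub hY _ 1).add (integrable_abs_sub hY _ (-1))) (fun u => by
      have h₁ := neg_abs_le ((u : ℝ) - 1)
      have h₂ := le_abs_self ((u : ℝ) - (-1))
      simp only [Pi.add_apply]
      linarith)
  simpa using h

/-- If the forecaster survives all sign sequences of length `m`, then no tree of height at most `m`
has a positive payoff. -/
theorem payoff_add_nonpos (hWsymm : ∀ w ∈ W, -w ∈ W)
    (hXW : ∀ x ∈ X, ∀ w ∈ W, inner ℝ w x ≤ 1) (hY : IsCompact Y) (hYpos : (1 : ℝ) ∈ Y)
    (hYneg : (-1 : ℝ) ∈ Y) (hT : ∃ x₀ : X, Tbar x₀ = 0)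
    (q : List (X × Y) → X → ProbabilityMeasure Y) (m : ℕ) (t : SignTree X W) (ht : t.height ≤ m)
    (past : List (X × Y)) (v : EuclideanSpace ℝ (Fin d)) (s : S) (c : ℝ)
    (h : ∀ future : List (X × Y), future.length = m → ∀ w ∈ W,
      cumLoss (fun u y => |u - y|) q past future
        - (future.map fun z => |inner ℝ w (z.1 : EuclideanSpace ℝ (Fin d)) - z.2|).sum
        + inner ℝ w v + c ≤ F (s + (future.map fun z => Tbar z.1).sum)) :
    t.payoff Tbar F v s + c ≤ 0 := by
  induction m generalizing t past v s c with
  | zero =>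
    cases t with
    | leaf w =>
      have := h [] rfl w w.2
      simp only [cumLoss, List.map_nil, List.sum_nil, add_zero] at this
      simp only [SignTree.payoff]
      linarith
    | node x l r => simp [SignTree.height] at ht
  | succ m ih =>
    have step : ∀ (x : X) (l r : SignTree X W), l.height ≤ m → r.height ≤ m →
        (SignTree.node x l r).payoff Tbar F v s + c ≤ 0 := by
      intro x l r hl hr
      -- As `|⟨w, x⟩ - 1| = 1 - ⟨w, x⟩`, the label 1 shifts v by x, and c collects the forecaster's
      -- loss minus 1. The label -1 is symmetric.
      have h₁ := ih l hl (past ++ [(x, ⟨1, hYpos⟩)]) (v + x) (s + Tbar x)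
        (c + ∫ u : Y, |(u : ℝ) - 1| ∂(q past x : Measure Y) - 1) (fun future hf w hw => by
          have := h ((x, ⟨1, hYpos⟩) :: future) (by simp [hf]) w hw
          simp only [cumLoss, List.map_cons, List.sum_cons] at this
          rw [abs_of_nonpos (by linarith [(abs_inner_le_one hWsymm hXW x.2 hw).2])] at this
          rw [inner_add_right, add_assoc s]
          linarith)
      have h₂ := ih r hr (past ++ [(x, ⟨-1, hYneg⟩)]) (v - x) (s + Tbar x)
        (c + ∫ u : Y, |(u : ℝ) - (-1)| ∂(q past x : Measure Y) - 1) (fun future hf w hw => by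
          have := h ((x, ⟨-1, hYneg⟩) :: future) (by simp [hf]) w hw
          simp only [cumLoss, List.map_cons, List.sum_cons] at this
          rw [abs_of_nonneg (a := _ - _)
            (by linarith [(abs_inner_le_one hWsymm hXW x.2 hw).1])] at this
          rw [inner_sub_right, add_assoc s]
          linarith)
      have h₃ := two_le_integral_abs_add hY (q past x)
      simp only [SignTree.payoff]
      linarith
    cases t with
    | leaf w =>
      -- Spare rounds are filled with x₀: two copies of the leaf average back to it, and `Tbar x₀ =
      -- 0` leaves s unchanged.
      obtain ⟨x₀, hx₀⟩ := hT
      have := step x₀ (SignTree.leaf w) (SignTree.leaf w) (Nat.zero_le _) (Nat.zero_le _)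
      simp only [SignTree.payoff, hx₀, add_zero, inner_add_right, inner_sub_right] at this ⊢
      linarith
    | node x l r =>
      have := Nat.le_of_succ_le_succ ht
      exact step x l r ((le_max_left _ _).trans this) ((le_max_right _ _).trans this)

theorem Achievable.nonposPayoff (hWsymm : ∀ w ∈ W, -w ∈ W)
    (hXW : ∀ x ∈ X, ∀ w ∈ W, inner ℝ w x ≤ 1) (hY : IsCompact Y) (hYpos : (1 : ℝ) ∈ Y)
    (hYneg : (-1 : ℝ) ∈ Y) (hT : ∃ x₀ : X, Tbar x₀ = 0)
    (h : Achievable X W Y Tbar F (fun u y => |u - y|)) : NonposPayoff X W Tbar F := by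
  intro t
  -- The extra round is needed because a leaf has height 0 and horizons start at 1.
  obtain ⟨q, hq⟩ := h.exists_regretLE (fun _ _ => abs_nonneg _) (Nat.le_add_left 1 t.height)
  have := payoff_add_nonpos (F := F) hWsymm hXW hY hYpos hYneg hT q (t.height + 1) t
    (Nat.le_succ _) [] 0 0 0 (fun future hf w hw => by
      simpa using hq future hf w hw)
  simpa using this

/-! ### The forecaster -/

/-- A bound on all payoffs can be maintained over one round by a prediction `g`. -/
theorem exists_prediction (hWsymm : ∀ w ∈ W, -w ∈ W)
    (hXW : ∀ x ∈ X, ∀ w ∈ W, inner ℝ w x ≤ 1)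
    {v : EuclideanSpace ℝ (Fin d)} {s : S} {M : ℝ}
    (hM : ∀ t : SignTree X W, t.payoff Tbar F v s ≤ M) (x : X) :
    ∃ g ∈ Set.Icc (-1 : ℝ) 1, ∀ δ ∈ Set.Icc (-1 : ℝ) 1, ∀ t : SignTree X W,
      t.payoff Tbar F (v - δ • (x : EuclideanSpace ℝ (Fin d))) (s + Tbar x) ≤ M - δ * g := by
  have hnode : ∀ l r : SignTree X W,
      l.payoff Tbar F v (s + Tbar x) + inner ℝ l.gradient (x : EuclideanSpace ℝ (Fin d))
        + (r.payoff Tbar F v (s + Tbar x) - inner ℝ r.gradient (x : EuclideanSpace ℝ (Fin d)))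
        ≤ 2 * M := fun l r => by
    have := hM (SignTree.node x l r)
    have e := r.payoff_sub_smul Tbar F v x (s + Tbar x) 1
    rw [one_smul] at e
    simp only [SignTree.payoff, SignTree.payoff_add, e] at this
    linarith
  have hgrad : ∀ t : SignTree X W,
      inner ℝ t.gradient (x : EuclideanSpace ℝ (Fin d)) ∈ Set.Icc (-1 : ℝ) 1 := fun t => by
    refine ⟨?_, t.inner_gradient_le (hXW x x.2)⟩
    have := t.inner_gradient_le (u := -(x : EuclideanSpace ℝ (Fin d))) (C := 1) fun w hw => by
      rw [inner_neg_right]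
      linarith [(abs_inner_le_one hWsymm hXW x.2 hw).1]
    rw [inner_neg_right] at this
    linarith
  -- The two families are the constraints on g at δ = -1 and δ = 1, compatible by `hnode`. Both
  -- sides of the goal are affine in δ, so these endpoints suffice.
  obtain ⟨g, h₁, h₂⟩ := exists_between_sets
    (A := insert (-1) (Set.range fun t : SignTree X W => t.payoff Tbar F v (s + Tbar x)
      + inner ℝ t.gradient (x : EuclideanSpace ℝ (Fin d)) - M))
    (B := insert 1 (Set.range fun t : SignTree X W => M - (t.payoff Tbar F v (s + Tbar x)
      - inner ℝ t.gradient (x : EuclideanSpace ℝ (Fin d)))))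
    ⟨_, Set.mem_insert _ _⟩ ⟨_, Set.mem_insert _ _⟩ (by
      rintro a (rfl | ⟨l, rfl⟩) b (rfl | ⟨r, rfl⟩)
      · norm_num
      · dsimp only
        linarith [hnode r r, (hgrad r).1]
      · dsimp only
        linarith [hnode l l, (hgrad l).2]
      · dsimp only
        linarith [hnode l r])
  refine ⟨g, ⟨h₁ _ (Set.mem_insert _ _), h₂ _ (Set.mem_insert _ _)⟩, fun δ hδ t => ?_⟩
  have k₁ := h₁ _ (Set.mem_insert_of_mem _ ⟨t, rfl⟩)
  have k₂ := h₂ _ (Set.mem_insert_of_mem _ ⟨t, rfl⟩)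
  dsimp only at k₁ k₂
  rw [SignTree.payoff_sub_smul]
  have m₁ := mul_le_mul_of_nonneg_left (sub_le_iff_le_add.1 k₁) (sub_nonneg.2 hδ.2)
  have m₂ := mul_le_mul_of_nonneg_left (le_sub_comm.1 k₂) (by linarith [hδ.1] : 0 ≤ 1 + δ)
  linarith

/-- The state of the forecaster: a point `(v, s)` and a bound on all payoffs there. -/
structure ForecasterState (X W : Set (EuclideanSpace ℝ (Fin d))) (Tbar : X → S) (F : S → ℝ) where
  vec : EuclideanSpace ℝ (Fin d)
  stat : S
  bound : ℝ
  payoff_le : ∀ t : SignTree X W, t.payoff Tbar F vec stat ≤ bound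

/-- For every w at once, the drop of the potential `bound - ⟨w, vec⟩` pays for the regret of the
round. -/
theorem exists_forecaster_step (hWsymm : ∀ w ∈ W, -w ∈ W)
    (hXW : ∀ x ∈ X, ∀ w ∈ W, inner ℝ w x ≤ 1) (hY : IsCompact Y) (hYpos : (1 : ℝ) ∈ Y)
    (hYneg : (-1 : ℝ) ∈ Y) {ℓ : ℝ → ℝ → ℝ} (hℓ : IsAdmissibleLoss Y ℓ)
    (σ : ForecasterState X W Tbar F) (x : X) :
    ∃ q : ProbabilityMeasure Y, ∀ y : Y, ∃ σ' : ForecasterState X W Tbar F,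
      σ'.stat = σ.stat + Tbar x ∧ ∀ w ∈ W,
        ∫ u : Y, ℓ u y ∂(q : Measure Y) - ℓ (inner ℝ w (x : EuclideanSpace ℝ (Fin d))) y
          ≤ (σ.bound - inner ℝ w σ.vec) - (σ'.bound - inner ℝ w σ'.vec) := by
  obtain ⟨g, hg, hstep⟩ := exists_prediction hWsymm hXW σ.payoff_le x
  obtain ⟨q, hq⟩ := exists_randomized_prediction hY hYpos hYneg hℓ hg
  refine ⟨q, fun y => ?_⟩
  -- δ depends on the label, revealed after g is fixed; `hstep` covers every δ.
  obtain ⟨δ, hδ, hsub⟩ := exists_subgradient (hℓ.convex y y.2) (hℓ.lipschitz y y.2)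
    (mem_convexHull_of_mem_Icc hYpos hYneg hg)
  refine ⟨⟨_, _, _, hstep δ hδ⟩, rfl, fun w hw => ?_⟩
  have h₁ := hq y
  have h₂ := hsub _ (mem_convexHull_of_mem_Icc hYpos hYneg (abs_inner_le_one hWsymm hXW x.2 hw))
  simp only [inner_sub_right, real_inner_smul_right]
  linarith

/-- The drops telescope from potential 0, and the leaf w bounds the final potential below by -F. The
forecaster does not depend on the horizon. -/
theorem NonposPayoff.achievable (hW : W.Nonempty) (hWsymm : ∀ w ∈ W, -w ∈ W)
    (hXW : ∀ x ∈ X, ∀ w ∈ W, inner ℝ w x ≤ 1) (hY : IsCompact Y) (hYpos : (1 : ℝ) ∈ Y)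
    (hYneg : (-1 : ℝ) ∈ Y) (h : NonposPayoff X W Tbar F) {ℓ : ℝ → ℝ → ℝ}
    (hℓ : IsAdmissibleLoss Y ℓ) : Achievable X W Y Tbar F ℓ := by
  choose law next hstat hdrop using exists_forecaster_step (Tbar := Tbar) (F := F) hWsymm hXW
    hY hYpos hYneg hℓ
  let state : List (X × Y) → ForecasterState X W Tbar F :=
    fun past => past.foldl (fun σ z => next σ z.1 z.2) ⟨0, 0, 0, h⟩
  have hstate : ∀ past z, state (past ++ [z]) = next (state past) z.1 z.2 := fun past z => by
    simp [state]
  let q : List (X × Y) → X → ProbabilityMeasure Y := fun past x => law (state past) x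
  have key : ∀ (future past : List (X × Y)), ∀ w ∈ W, cumLoss ℓ q past future
      - (future.map fun z => ℓ (inner ℝ w (z.1 : EuclideanSpace ℝ (Fin d))) z.2).sum
      ≤ (state past).bound - inner ℝ w (state past).vec
        + F ((state past).stat + (future.map fun z => Tbar z.1).sum) := by
    intro future
    induction future with
    | nil =>
      intro past w hw
      have := (state past).payoff_le (SignTree.leaf ⟨w, hw⟩)
      simp only [SignTree.payoff] at this
      simp only [cumLoss, List.map_nil, List.sum_nil, add_zero]
      linarith
    | cons z future ih =>
      intro past w hw
      have h₁ := ih (past ++ [z]) w hw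
      have h₂ := hdrop (state past) z.1 z.2 w hw
      rw [hstate, hstat, add_assoc] at h₁
      simp only [cumLoss, List.map_cons, List.sum_cons]
      change ∫ u : Y, ℓ u z.2 ∂(law (state past) z.1 : Measure Y) + _ - _ ≤ _
      linarith
  refine achievable_of_regretLE hW (q := q) fun rounds w hw => ?_
  simpa [state] using key rounds [] w hw

end OnlineLearning

end

/-! ### The equivalences -/

theorem mainTheorem11 {d : ℕ} {S : Type*} [AddCommGroup S] [Module ℝ S]
    (X W : Set (EuclideanSpace ℝ (Fin d))) (Y : Set ℝ)
    (hW : W.Nonempty) (hWsymm : ∀ w ∈ W, -w ∈ W)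
    (hXW : ∀ x ∈ X, ∀ w ∈ W, inner ℝ w x ≤ 1)
    (hY : IsCompact Y) (hYpos : (1 : ℝ) ∈ Y) (hYneg : (-1 : ℝ) ∈ Y)
    (Tbar : X → S) (F : S → ℝ) (hT : ∃ x₀ : X, Tbar x₀ = 0) :
    List.TFAE [
      ∃ U : ℝ × EuclideanSpace ℝ (Fin d) × S → EReal,
        OnlineLearning.IsBurkholder
          (OnlineLearning.natT X Y Tbar) (OnlineLearning.natV W F) U,
      ∃ U : ℝ × EuclideanSpace ℝ (Fin d) × S → EReal,
        OnlineLearning.IsConvexBurkholder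
          (OnlineLearning.natT X Y Tbar) (OnlineLearning.natV W F) U,
      ∀ ℓ : ℝ → ℝ → ℝ, OnlineLearning.IsAdmissibleLoss Y ℓ →
        OnlineLearning.Achievable X W Y Tbar F ℓ,
      OnlineLearning.Achievable X W Y Tbar F (fun u y => |u - y|)]
    ∧
    (Bornology.IsBounded W →
      (∀ s : S, ∃ C : ℝ, ∀ (m : ℕ) (x : Fin m → X),
        F (∑ t, Tbar (x t)) ≤ F (s + ∑ t, Tbar (x t)) + C) →
      List.TFAE [
        ∃ U : ℝ × EuclideanSpace ℝ (Fin d) × S → ℝ,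
          OnlineLearning.IsBurkholder
            (OnlineLearning.natT X Y Tbar) (OnlineLearning.natV W F) (fun τ => (U τ : EReal)),
        ∃ U : ℝ × EuclideanSpace ℝ (Fin d) × S → ℝ,
          OnlineLearning.IsConvexBurkholder
            (OnlineLearning.natT X Y Tbar) (OnlineLearning.natV W F) (fun τ => (U τ : EReal)),
        ∀ ℓ : ℝ → ℝ → ℝ, OnlineLearning.IsAdmissibleLoss Y ℓ →
          OnlineLearning.Achievable X W Y Tbar F ℓ,
        OnlineLearning.Achievable X W Y Tbar F (fun u y => |u - y|)]) := by
  have hR₁ : ∀ U : ℝ × EuclideanSpace ℝ (Fin d) × S → EReal,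
      OnlineLearning.IsBurkholder (OnlineLearning.natT X Y Tbar) (OnlineLearning.natV W F) U →
      OnlineLearning.NonposPayoff X W Tbar F := fun U hU =>
    OnlineLearning.nonposPayoff_of_add_payoff_le hU.zero_le (hU.add_payoff_le hYpos)
  have hR₂ : ∀ U : ℝ × EuclideanSpace ℝ (Fin d) × S → EReal,
      OnlineLearning.IsConvexBurkholder (OnlineLearning.natT X Y Tbar) (OnlineLearning.natV W F) U →
      OnlineLearning.NonposPayoff X W Tbar F := fun U hU =>
    OnlineLearning.nonposPayoff_of_add_payoff_le hU.zero_le (hU.add_payoff_le hYpos)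
  have hR₃ : OnlineLearning.NonposPayoff X W Tbar F → ∀ ℓ : ℝ → ℝ → ℝ,
      OnlineLearning.IsAdmissibleLoss Y ℓ → OnlineLearning.Achievable X W Y Tbar F ℓ :=
    fun h ℓ hℓ => h.achievable hW hWsymm hXW hY hYpos hYneg hℓ
  have hR₄ : OnlineLearning.Achievable X W Y Tbar F (fun u y => |u - y|) →
      OnlineLearning.NonposPayoff X W Tbar F := fun h =>
    h.nonposPayoff hWsymm hXW hY hYpos hYneg hT
  have habs := OnlineLearning.isAdmissibleLoss_abs hY ⟨1, hYpos⟩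
  refine ⟨?_, fun hWb hF => ?_⟩
  · tfae_have 1 → 3 := fun ⟨U, hU⟩ => hR₃ (hR₁ U hU)
    tfae_have 2 → 1 := fun ⟨U, hU⟩ => ⟨U, hU.isBurkholder hW⟩
    tfae_have 3 → 4 := fun h => h _ habs
    tfae_have 4 → 2 := fun h => ⟨_, OnlineLearning.isConvexBurkholder_leastU hW (hR₄ h)⟩
    tfae_finish
  · tfae_have 1 → 3 := fun ⟨U, hU⟩ => hR₃ (hR₁ _ hU)
    tfae_have 2 → 1 := fun ⟨U, hU⟩ => ⟨U, hU.isBurkholder hW⟩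
    tfae_have 3 → 4 := fun h => h _ habs
    tfae_have 4 → 2 := fun h => by
      obtain ⟨U, hU⟩ := OnlineLearning.exists_real_leastU hW hWb hF (hR₄ h)
      exact ⟨U, hU ▸ OnlineLearning.isConvexBurkholder_leastU hW (hR₄ h)⟩
    tfae_finish
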